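/- **Theorem 5.** Let $X_1,X_2,\dots$ be i.i.d. real random variables with density $f(x-\theta)$, where $\theta\in\mathbb R$ and $f$ is a probability density with $f(-x)=f(x)$; let $F(x)=\int_{-\infty}^x f(t)\,dt$. Assume that $f'$ exists and is continuous in a neighbourhood of $-\theta$ and that $0<F(\theta)<1$ (automatic if $\theta=0$). Let $k:\mathbb R\to\mathbb R$ be an integrable kernel, not necessarily nonnegative, with $\int_{-\infty}^{\infty}k(u)\,du=1$ and $k(-u)=k(u)$; put $K(t)=\int_{-\infty}^t k(u)\,du$. Let $h_n=cn^{-d}$ with $c>0$ and $\frac14<d<\frac12$, and $$\widetilde W=\widetilde W_n=\frac{n(n+1)}2-\sum_{1\le i\le j\le n}K\left(-\frac{X_i+X_j}{2h_n}\right).$$ Then $\widetilde W_n$ has finite second moment for every $n$, its variance $V_\theta(\widetilde W_n)$ is positive for all sufficiently large $n$, and $$\frac{\widetilde W_n-E_\theta(\widetilde W_n)}{\sqrt{V_\theta(\widetilde W_n)}}\longrightarrow N(0,1)\quad\text{in law as } n\to\infty .$$ -/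

import Mathlib

open MeasureTheory ProbabilityTheory Filter Topology

noncomputable section

/-- The primitive `x ↦ ∫_{-∞}^x g(t) dt`. It gives the distribution function `F` of a density `f`
and the integrated kernel `K` of a kernel `k`. -/
def primitiveFromBot (g : ℝ → ℝ) (x : ℝ) : ℝ :=
  ∫ t in Set.Iic x, g t

/-- The smoothed Wilcoxon signed-rank statistic of the sample `x 0, …, x (n - 1)` with kernel `k`
and bandwidth `h`:
`n (n + 1) / 2 - ∑_{i ≤ j} K (-(x i + x j) / (2 h))`, the diagonal `i = j` included. -/
def smoothedWilcoxon (k : ℝ → ℝ) (h : ℝ) (n : ℕ) (x : ℕ → ℝ) : ℝ :=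
  (n : ℝ) * ((n : ℝ) + 1) / 2
    - ∑ j ∈ Finset.range n, ∑ i ∈ Finset.range (j + 1),
        primitiveFromBot k (-((x i + x j) / (2 * h)))

end

/-!
The statistic is a double sum `∑_{i ≤ j} gₙ(Xᵢ, Xⱼ)` with the symmetric kernel
`gₙ(x, y) = 1 - K(-(x + y) / (2 hₙ))`, which is bounded by `1 + ∫ |k|` and converges to the indicator
of `x + y > 0` off the line `x + y = 0`. That line is met with probability zero since the law `μ` of
the observations has a density.

Put `aₙ(x) = E gₙ(x, X)` and `a(x) = P(x + X > 0)`. The Hoeffding decomposition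
(`sum_le_pairs_hoeffding`) splits the sum into a degenerate double sum, the diagonal, the linear part
`(n - 1) ∑ (aₙ(Xᵢ) - E aₙ)` and a constant. The summands of the degenerate part are orthogonal, so
it is `O(n)` in `L²` (`integral_sq_sum_degenerate_le`), and the diagonal is trivially `O(n)`; both are
negligible after division by `n ^ (3 / 2)`. By dominated convergence `aₙ → a` in `L²(μ)`, so the
linear part may be replaced by `n ∑ (a(Xᵢ) - E a)` (`tendsto_variance_sum_le_pairs_sub`), to which
the classical central limit theorem applies. An error that is small in `L²` changes neither the
asymptotic variance nor the limit law of the standardized statistic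
(`tendstoInDistribution_standardize`).

The limiting variance `Var a(X)` is positive: by the symmetry of `f`, `P(X > 0) = F(θ)` lies strictly
between `0` and `1`, and then `x ↦ μ(-x, ∞)` is not almost surely constant
(`not_ae_eq_const_measureReal_Ioi_neg`).
-/

/-! ### Orthogonality in degenerate double sums -/

section Degenerate

variable {Ω : Type*} [MeasurableSpace Ω] {P : Measure Ω} [IsProbabilityMeasure P]
  {μ : Measure ℝ} {X : ℕ → Ω → ℝ}

/-- By Fubini, a bounded function of `(V, Y)` with `V` and `Y` independent has mean zero as soon as
it averages to zero in the second variable. -/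
lemma integral_comp_eq_zero_of_indepFun [IsProbabilityMeasure μ] {E : Type*} [MeasurableSpace E]
    {V : Ω → E} {Y : Ω → ℝ}
    (hV : AEMeasurable V P) (hY : HasLaw Y μ P) (hind : IndepFun V Y P) {Φ : E → ℝ → ℝ}
    (hΦ : Measurable (Function.uncurry Φ)) {C : ℝ} (hC : ∀ v y, |Φ v y| ≤ C)
    (h0 : ∀ v, ∫ y, Φ v y ∂μ = 0) : ∫ ω, Φ (V ω) (Y ω) ∂P = 0 := by
  have hm := (indepFun_iff_map_prod_eq_prod_map_map hV hY.aemeasurable).1 hind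
  rw [hY.map_eq] at hm
  have : IsProbabilityMeasure (P.map V) := Measure.isProbabilityMeasure_map hV
  calc ∫ ω, Φ (V ω) (Y ω) ∂P
      = ∫ z, Function.uncurry Φ z ∂(P.map (fun ω => (V ω, Y ω))) :=
        (integral_map (hV.prodMk hY.aemeasurable) hΦ.aestronglyMeasurable).symm
    _ = ∫ v, ∫ y, Φ v y ∂μ ∂(P.map V) := by
        rw [hm, integral_prod]
        · rfl
        · exact .of_bound hΦ.aestronglyMeasurable C (.of_forall fun z => hC z.1 z.2)
    _ = 0 := by simp [h0]

lemma integral_comp_eq_zero_of_notMem [IsProbabilityMeasure μ]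
    (hX : ∀ i, HasLaw (X i) μ P) (hind : iIndepFun X P)
    {s : Finset ℕ} {l : ℕ} (hl : l ∉ s) {Φ : (s → ℝ) → ℝ → ℝ}
    (hΦ : Measurable (Function.uncurry Φ)) {C : ℝ} (hC : ∀ v y, |Φ v y| ≤ C)
    (h0 : ∀ v, ∫ y, Φ v y ∂μ = 0) : ∫ ω, Φ (fun i => X i ω) (X l ω) ∂P = 0 := by
  have hm : ∀ i, AEMeasurable (X i) P := fun i => (hX i).aemeasurable
  refine integral_comp_eq_zero_of_indepFun (V := fun ω (i : s) => X i ω) (aemeasurable_pi_lambda _ fun i => hm i) (hX l) ?_ hΦ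
    hC h0
  have h := hind.indepFun_finset₀ s {l} (by simpa using hl) hm
  exact h.comp (φ := id) (ψ := fun v : (({l} : Finset ℕ) → ℝ) => v ⟨l, by simp⟩) measurable_id
    (measurable_pi_apply _)

/-- The summands of a degenerate symmetric double sum are orthogonal. -/
lemma integral_mul_eq_zero_of_degenerate [IsProbabilityMeasure μ]
    (hX : ∀ i, HasLaw (X i) μ P) (hind : iIndepFun X P)
    {ρ : ℝ → ℝ → ℝ} (hρ : Measurable (Function.uncurry ρ)) (hsymm : ∀ x y, ρ x y = ρ y x)
    {C : ℝ} (hC : ∀ x y, |ρ x y| ≤ C) (h0 : ∀ x, ∫ y, ρ x y ∂μ = 0)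
    {i j k l : ℕ} (hij : i < j) (hkl : k < l) (hne : (i, j) ≠ (k, l)) :
    ∫ ω, ρ (X i ω) (X j ω) * ρ (X k ω) (X l ω) ∂P = 0 := by
  have hC0 : 0 ≤ C := (abs_nonneg _).trans (hC 0 0)
  -- `b` differs from the other three indices, so `X b` can be integrated out first
  have key : ∀ a b c e : ℕ, b ∉ ({a, c, e} : Finset ℕ) →
      ∫ ω, ρ (X a ω) (X b ω) * ρ (X c ω) (X e ω) ∂P = 0 := by
    intro a b c e hb
    refine integral_comp_eq_zero_of_notMem hX hind hb
      (Φ := fun v y => ρ (v ⟨a, by simp⟩) y * ρ (v ⟨c, by simp⟩) (v ⟨e, by simp⟩))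
      (C := C * C) ?_ ?_ ?_
    · exact (hρ.comp (f := fun z : (({a, c, e} : Finset ℕ) → ℝ) × ℝ => (z.1 ⟨a, by simp⟩, z.2))
        (by fun_prop)).mul (hρ.comp (f := fun z : (({a, c, e} : Finset ℕ) → ℝ) × ℝ =>
          (z.1 ⟨c, by simp⟩, z.1 ⟨e, by simp⟩)) (by fun_prop))
    · intro v y
      rw [abs_mul]
      exact mul_le_mul (hC _ _) (hC _ _) (abs_nonneg _) hC0
    · intro v
      rw [integral_mul_const, h0, zero_mul]
  rcases lt_trichotomy j l with h | h | h
  · have := key k l i j (by simp; omega)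
    simpa only [mul_comm] using this
  · subst h
    have hik : i ≠ k := fun h => hne (by rw [h])
    have := key j i k j (by simp; omega)
    simpa only [hsymm (X j _) (X i _)] using this
  · exact key i j k l (by simp; omega)

lemma integral_sq_sum_degenerate_le [IsProbabilityMeasure μ]
    (hX : ∀ i, HasLaw (X i) μ P) (hind : iIndepFun X P)
    {ρ : ℝ → ℝ → ℝ} (hρ : Measurable (Function.uncurry ρ)) (hsymm : ∀ x y, ρ x y = ρ y x)
    {C : ℝ} (hC : ∀ x y, |ρ x y| ≤ C) (h0 : ∀ x, ∫ y, ρ x y ∂μ = 0) (n : ℕ) :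
    ∫ ω, (∑ j ∈ Finset.range n, ∑ i ∈ Finset.range j, ρ (X i ω) (X j ω)) ^ 2 ∂P
      ≤ C ^ 2 * n ^ 2 := by
  have hC0 : 0 ≤ C := (abs_nonneg _).trans (hC 0 0)
  have hm : ∀ i, AEMeasurable (X i) P := fun i => (hX i).aemeasurable
  have hρm : ∀ i j, AEMeasurable (fun ω => ρ (X i ω) (X j ω)) P := fun i j =>
    hρ.comp_aemeasurable ((hm i).prodMk (hm j))
  have hb : ∀ x y x' y', |ρ x y * ρ x' y'| ≤ C ^ 2 := fun x y x' y' => by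
    rw [abs_mul, sq]; exact mul_le_mul (hC _ _) (hC _ _) (abs_nonneg _) hC0
  have hint : ∀ i j k l, Integrable (fun ω => ρ (X i ω) (X j ω) * ρ (X k ω) (X l ω)) P :=
    fun i j k l => .of_bound ((hρm i j).mul (hρm k l)).aestronglyMeasurable (C ^ 2)
      (.of_forall fun ω => hb _ _ _ _)
  set s := (Finset.range n).sigma fun j => Finset.range j
  have hs : ∀ ω, (∑ j ∈ Finset.range n, ∑ i ∈ Finset.range j, ρ (X i ω) (X j ω)) ^ 2
      = ∑ p ∈ s, ∑ q ∈ s, ρ (X p.2 ω) (X p.1 ω) * ρ (X q.2 ω) (X q.1 ω) := fun ω => by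
    rw [Finset.sum_sigma' (Finset.range n), sq, Finset.sum_mul_sum]
  simp_rw [hs]
  rw [integral_finsetSum _ fun p _ => integrable_finsetSum _ fun q _ => hint _ _ _ _]
  have hp : ∀ p ∈ s, ∫ ω, ∑ q ∈ s, ρ (X p.2 ω) (X p.1 ω) * ρ (X q.2 ω) (X q.1 ω) ∂P ≤ C ^ 2 := by
    intro p hp
    rw [integral_finsetSum _ fun q _ => hint _ _ _ _, Finset.sum_eq_single_of_mem p hp]
    · calc _ ≤ ∫ _, C ^ 2 ∂P := integral_mono (hint _ _ _ _) (integrable_const _)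
            fun ω => (le_abs_self _).trans (hb _ _ _ _)
        _ = C ^ 2 := by simp
    · intro q hq hqp
      simp only [s, Finset.mem_sigma, Finset.mem_range] at hp hq
      refine integral_mul_eq_zero_of_degenerate hX hind hρ hsymm hC h0 hp.2 hq.2 ?_
      rintro h
      simp only [Prod.mk.injEq] at h
      exact hqp (Sigma.ext h.2.symm (heq_of_eq h.1.symm))
  refine (Finset.sum_le_card_nsmul _ _ _ hp).trans ?_
  rw [nsmul_eq_mul, mul_comm]
  gcongr
  have : s.card ≤ n ^ 2 := by
    rw [Finset.card_sigma, sq]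
    simpa using Finset.sum_le_card_nsmul (Finset.range n) (fun j => (Finset.range j).card) n
      (fun j hj => by simpa using (Finset.mem_range.1 hj).le)
  exact_mod_cast this

lemma integral_sq_sum_of_centered (hX : ∀ i, HasLaw (X i) μ P) (hind : iIndepFun X P)
    {b : ℝ → ℝ} (hb : Measurable b) {C : ℝ} (hC : ∀ x, |b x| ≤ C) (h0 : ∫ x, b x ∂μ = 0) (n : ℕ) :
    ∫ ω, (∑ i ∈ Finset.range n, b (X i ω)) ^ 2 ∂P = n * ∫ x, b x ^ 2 ∂μ := by
  have hC0 : 0 ≤ C := (abs_nonneg _).trans (hC 0)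
  have hm : ∀ i, AEMeasurable (X i) P := fun i => (hX i).aemeasurable
  have hint : ∀ i j, Integrable (fun ω => b (X i ω) * b (X j ω)) P := fun i j =>
    .of_bound ((hb.comp_aemeasurable (hm i)).mul
      (hb.comp_aemeasurable (hm j))).aestronglyMeasurable (C * C) (.of_forall fun ω => by
        rw [norm_mul]; exact mul_le_mul (hC _) (hC _) (abs_nonneg _) hC0)
  simp_rw [sq, Finset.sum_mul_sum]
  rw [integral_finsetSum _ fun p _ => integrable_finsetSum _ fun q _ => hint _ _]
  have hp : ∀ i ∈ Finset.range n, ∫ ω, ∑ j ∈ Finset.range n, b (X i ω) * b (X j ω) ∂P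
      = ∫ x, b x * b x ∂μ := by
    intro i hi
    rw [integral_finsetSum _ fun q _ => hint _ _, Finset.sum_eq_single_of_mem i hi]
    · exact (hX i).integral_comp (f := fun x => b x * b x) (hb.mul hb).aestronglyMeasurable
    · intro j _ hji
      have h1 := ((hind.indepFun hji).comp hb hb).integral_fun_mul_eq_mul_integral
        (hb.comp_aemeasurable (hm j)).aestronglyMeasurable
        (hb.comp_aemeasurable (hm i)).aestronglyMeasurable
      have h2 := (hX j).integral_comp (f := b) hb.aestronglyMeasurable
      simp only [Function.comp_def] at h1 h2
      simp_rw [mul_comm (b (X i _))]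
      rw [h1, h2, h0, zero_mul]
  rw [Finset.sum_congr rfl hp]
  simp

end Degenerate

/-! ### Hoeffding decomposition and the projection error -/

section Projection

variable {Ω : Type*} [MeasurableSpace Ω] {P : Measure Ω} [IsProbabilityMeasure P]
  {μ : Measure ℝ} [IsProbabilityMeasure μ] {X : ℕ → Ω → ℝ}

/-- Each index below `n` lies in `n - 1` of the pairs `i < j < n`. -/
lemma sum_lt_pairs_add (a : ℕ → ℝ) (n : ℕ) :
    ∑ j ∈ Finset.range n, ∑ i ∈ Finset.range j, (a i + a j)
      = ((n : ℝ) - 1) * ∑ i ∈ Finset.range n, a i := by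
  induction n with
  | zero => simp
  | succ n ih =>
    rw [Finset.sum_range_succ, ih, Finset.sum_range_succ a, Finset.sum_add_distrib]
    simp
    ring

lemma sum_le_pairs_const (c : ℝ) (n : ℕ) :
    ∑ j ∈ Finset.range n, ∑ _i ∈ Finset.range (j + 1), c = (n : ℝ) * (n + 1) / 2 * c := by
  induction n with
  | zero => simp
  | succ n ih =>
    rw [Finset.sum_range_succ, ih]
    simp
    ring

/-- **Hoeffding decomposition** of the double sum, diagonal included: a degenerate double sum, the
diagonal, the linear part, and a constant. Here `a` and `m` stand for `x ↦ E g(x, X)` and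
`E g(X, X')`. -/
lemma sum_le_pairs_hoeffding (g : ℝ → ℝ → ℝ) (a : ℝ → ℝ) (m : ℝ) (x : ℕ → ℝ) (n : ℕ) :
    ∑ j ∈ Finset.range n, ∑ i ∈ Finset.range (j + 1), g (x i) (x j)
      = ∑ j ∈ Finset.range n, ∑ i ∈ Finset.range j, (g (x i) (x j) - a (x i) - a (x j) + m)
        + ∑ j ∈ Finset.range n, g (x j) (x j)
        + ((n : ℝ) - 1) * ∑ i ∈ Finset.range n, (a (x i) - m)
        + (n : ℝ) * (n - 1) / 2 * m := by
  have h1 : ∑ j ∈ Finset.range n, ∑ i ∈ Finset.range (j + 1), g (x i) (x j)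
      = ∑ j ∈ Finset.range n, ∑ i ∈ Finset.range j, g (x i) (x j)
        + ∑ j ∈ Finset.range n, g (x j) (x j) := by
    simp_rw [Finset.sum_range_succ, Finset.sum_add_distrib]
  have h2 := sum_lt_pairs_add (fun i => a (x i) - m / 2) n
  have h3 : ∑ j ∈ Finset.range n, ∑ i ∈ Finset.range j, (g (x i) (x j) - a (x i) - a (x j) + m)
      = ∑ j ∈ Finset.range n, ∑ i ∈ Finset.range j, g (x i) (x j)
        - ∑ j ∈ Finset.range n, ∑ i ∈ Finset.range j, (a (x i) - m / 2 + (a (x j) - m / 2)) := by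
    simp_rw [← Finset.sum_sub_distrib]
    refine Finset.sum_congr rfl fun j _ => Finset.sum_congr rfl fun i _ => by ring
  rw [h1, h3, h2]
  simp only [Finset.sum_sub_distrib, Finset.sum_const, Finset.card_range, nsmul_eq_mul]
  ring

/-- Quantitative comparison of the double sum `∑_{i ≤ j < n} g(Xᵢ, Xⱼ)` with a linear statistic
`n ∑ b(Xᵢ)`, where `b` is arbitrary. The first term of the bound comes from the degenerate part and
the diagonal; the second is the `L²` distance between the linear part of the Hoeffding decomposition
and the linear statistic. -/
lemma variance_sum_le_pairs_sub_le (hX : ∀ i, HasLaw (X i) μ P) (hind : iIndepFun X P)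
    {g : ℝ → ℝ → ℝ} (hg : Measurable (Function.uncurry g)) (hsymm : ∀ x y, g x y = g y x)
    {C : ℝ} (hC : ∀ x y, |g x y| ≤ C) {b : ℝ → ℝ} (hb : Measurable b) (hbC : ∀ x, |b x| ≤ C)
    {n : ℕ} (hn : 1 ≤ n) :
    Var[fun ω => (√n)⁻¹ * ((∑ j ∈ Finset.range n, ∑ i ∈ Finset.range (j + 1), g (X i ω) (X j ω)) / n
        - ∑ i ∈ Finset.range n, b (X i ω)); P]
      ≤ 51 * C ^ 2 * (n : ℝ)⁻¹
        + 3 * ∫ x, ((1 - (n : ℝ)⁻¹) * ((∫ y, g x y ∂μ) - ∫ x, ∫ y, g x y ∂μ ∂μ)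
          - (b x - ∫ x, b x ∂μ)) ^ 2 ∂μ := by
  have hC0 : 0 ≤ C := (abs_nonneg _).trans (hC 0 0)
  have hm : ∀ i, AEMeasurable (X i) P := fun i => (hX i).aemeasurable
  set a : ℝ → ℝ := fun x => ∫ y, g x y ∂μ
  set m := ∫ x, a x ∂μ
  set β := ∫ x, b x ∂μ
  have ha : Measurable a := by
    have := hg.stronglyMeasurable.integral_prod_right (ν := μ)
    exact this.measurable
  have haC : ∀ x, |a x| ≤ C := fun x => by
    have := norm_integral_le_of_norm_le_const (μ := μ) (f := g x) (C := C) (.of_forall (hC x))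
    simpa using this
  have hmC : |m| ≤ C := by
    have := norm_integral_le_of_norm_le_const (μ := μ) (f := a) (C := C) (.of_forall haC)
    simpa using this
  have hβC : |β| ≤ C := by
    have := norm_integral_le_of_norm_le_const (μ := μ) (f := b) (C := C) (.of_forall hbC)
    simpa using this
  have hgi : ∀ x, Integrable (g x) μ := fun x =>
    .of_bound (hg.comp measurable_prodMk_left).aestronglyMeasurable C (.of_forall (hC x))
  have hai : Integrable a μ := .of_bound ha.aestronglyMeasurable C (.of_forall haC)
  have hbi : Integrable b μ := .of_bound hb.aestronglyMeasurable C (.of_forall hbC)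
  -- the degenerate part of the kernel
  set ρ : ℝ → ℝ → ℝ := fun x y => g x y - a x - a y + m
  have hρ : Measurable (Function.uncurry ρ) :=
    ((hg.sub (ha.comp measurable_fst)).sub (ha.comp measurable_snd)).add_const m
  have hρC : ∀ x y, |ρ x y| ≤ 4 * C := fun x y => by
    have h1 := abs_le.1 (hC x y)
    have h2 := abs_le.1 (haC x)
    have h3 := abs_le.1 (haC y)
    have h4 := abs_le.1 hmC
    rw [abs_le]
    constructor <;> simp only [ρ] <;> linarith
  have hρ0 : ∀ x, ∫ y, ρ x y ∂μ = 0 := fun x => by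
    have : ∫ y, ρ x y ∂μ = a x - a x - m + m := by
      simp only [ρ]
      have h1 := hgi x
      rw [integral_add (by fun_prop) (by fun_prop), integral_sub (by fun_prop) (by fun_prop),
        integral_sub (by fun_prop) (by fun_prop)]
      simp [a, m]
    rw [this]; ring
  have hρs : ∀ x y, ρ x y = ρ y x := fun x y => by simp only [ρ]; rw [hsymm x y]; ring
  -- the linear error term
  set e : ℝ → ℝ := fun x => (1 - (n : ℝ)⁻¹) * (a x - m) - (b x - β)
  have he : Measurable e := by fun_prop
  have hn0 : (0 : ℝ) < n := by exact_mod_cast hn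
  have hn1 : (n : ℝ)⁻¹ ≤ 1 := inv_le_one_of_one_le₀ (by exact_mod_cast hn)
  have hni : 0 < (n : ℝ)⁻¹ := inv_pos.2 hn0
  have heC : ∀ x, |e x| ≤ 4 * C := fun x => by
    have h1 : |a x - m| ≤ 2 * C := (abs_sub _ _).trans (by linarith [haC x])
    have h2 : |b x - β| ≤ 2 * C := (abs_sub _ _).trans (by linarith [hbC x])
    have h3 : |(1 - (n : ℝ)⁻¹) * (a x - m)| ≤ 1 * (2 * C) := by
      rw [abs_mul]
      exact mul_le_mul (abs_le.2 ⟨by linarith, by linarith⟩) h1 (abs_nonneg _) zero_le_one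
    exact (abs_sub _ _).trans (by linarith)
  have he0 : ∫ x, e x ∂μ = 0 := by
    simp only [e]
    rw [integral_sub (by fun_prop) (by fun_prop), integral_const_mul,
      integral_sub hai (integrable_const _),
      integral_sub hbi (integrable_const _)]
    simp [m, β]
  set Q : Ω → ℝ := fun ω => ∑ j ∈ Finset.range n, ∑ i ∈ Finset.range j, ρ (X i ω) (X j ω)
  set D : Ω → ℝ := fun ω => ∑ j ∈ Finset.range n, g (X j ω) (X j ω)
  set E : Ω → ℝ := fun ω => ∑ j ∈ Finset.range n, e (X j ω)
  have hgm : ∀ i j, AEMeasurable (fun ω => g (X i ω) (X j ω)) P := fun i j =>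
    hg.comp_aemeasurable ((hm i).prodMk (hm j))
  have hρm : ∀ i j, AEMeasurable (fun ω => ρ (X i ω) (X j ω)) P := fun i j =>
    hρ.comp_aemeasurable ((hm i).prodMk (hm j))
  have hem : ∀ i, AEMeasurable (fun ω => e (X i ω)) P := fun i => he.comp_aemeasurable (hm i)
  have hQ2 : MemLp Q 2 P := memLp_finsetSum _ fun j _ => memLp_finsetSum _ fun i _ =>
    .of_bound (hρm i j).aestronglyMeasurable (4 * C) (.of_forall fun ω => hρC _ _)
  have hE2 : MemLp E 2 P := memLp_finsetSum _ fun j _ =>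
    .of_bound (hem j).aestronglyMeasurable (4 * C) (.of_forall fun ω => heC _)
  have hD2 : MemLp D 2 P := memLp_finsetSum _ fun j _ =>
    .of_bound (hgm j j).aestronglyMeasurable C (.of_forall fun ω => hC _ _)
  have hDn : ∀ ω, D ω ^ 2 ≤ C ^ 2 * n ^ 2 := fun ω => by
    have : |D ω| ≤ n * C := by
      refine (Finset.abs_sum_le_sum_abs _ _).trans ?_
      simpa using Finset.sum_le_card_nsmul (Finset.range n) (fun j => |g (X j ω) (X j ω)|) C
        fun j _ => hC _ _
    calc D ω ^ 2 = |D ω| ^ 2 := (sq_abs _).symm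
      _ ≤ (n * C) ^ 2 := by gcongr
      _ = _ := by ring
  have hQn : ∫ ω, Q ω ^ 2 ∂P ≤ (4 * C) ^ 2 * n ^ 2 :=
    integral_sq_sum_degenerate_le hX hind hρ hρs hρC hρ0 n
  have hEn : ∫ ω, E ω ^ 2 ∂P = n * ∫ x, e x ^ 2 ∂μ :=
    integral_sq_sum_of_centered hX hind he heC he0 n
  set Z : Ω → ℝ := fun ω => (√n)⁻¹ * ((n : ℝ)⁻¹ * Q ω + (n : ℝ)⁻¹ * D ω + E ω)
  have hZ2 : MemLp Z 2 P := (((hQ2.const_mul _).add (hD2.const_mul _)).add hE2).const_mul _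
  have hdecomp : (fun ω => (√n)⁻¹ * ((∑ j ∈ Finset.range n, ∑ i ∈ Finset.range (j + 1),
        g (X i ω) (X j ω)) / n - ∑ i ∈ Finset.range n, b (X i ω)))
      = fun ω => Z ω + (√n)⁻¹ * (((n : ℝ) - 1) / 2 * m - n * β) := by
    funext ω
    rw [sum_le_pairs_hoeffding g a m (fun i => X i ω) n]
    have hE : E ω = (1 - (n : ℝ)⁻¹) * ∑ i ∈ Finset.range n, (a (X i ω) - m)
        - (∑ i ∈ Finset.range n, b (X i ω) - n * β) := by
      simp only [E, e, Finset.sum_sub_distrib, ← Finset.mul_sum]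
      simp
    simp only [Z, hE]
    have h1 : ∑ j ∈ Finset.range n, ∑ i ∈ Finset.range j,
      (g (X i ω) (X j ω) - a (X i ω) - a (X j ω) + m) = Q ω := rfl
    have h2 : ∑ j ∈ Finset.range n, g (X j ω) (X j ω) = D ω := rfl
    rw [h1, h2]
    generalize ∑ i ∈ Finset.range n, (a (X i ω) - m) = A
    field_simp
    ring
  rw [hdecomp, variance_add_const hZ2.aestronglyMeasurable]
  have hsq : ∀ ω, Z ω ^ 2 ≤ 3 * (n : ℝ)⁻¹ * ((n : ℝ)⁻¹ ^ 2 * Q ω ^ 2 + C ^ 2 + E ω ^ 2) := fun ω => by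
    have h1 : Z ω ^ 2 = (n : ℝ)⁻¹ * ((n : ℝ)⁻¹ * Q ω + (n : ℝ)⁻¹ * D ω + E ω) ^ 2 := by
      simp only [Z]
      rw [mul_pow, inv_pow, Real.sq_sqrt hn0.le]
    have h2 : ((n : ℝ)⁻¹ * D ω) ^ 2 ≤ C ^ 2 := by
      rw [mul_pow]
      calc (n : ℝ)⁻¹ ^ 2 * D ω ^ 2 ≤ (n : ℝ)⁻¹ ^ 2 * (C ^ 2 * n ^ 2) := by gcongr; exact hDn ω
        _ = C ^ 2 := by field_simp
    rw [h1, mul_comm 3, mul_assoc]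
    gcongr
    have h3 : ∀ x y z : ℝ, (x + y + z) ^ 2 ≤ 3 * (x ^ 2 + y ^ 2 + z ^ 2) := fun x y z => by
      nlinarith [sq_nonneg (x - y), sq_nonneg (y - z), sq_nonneg (x - z)]
    refine (h3 _ _ _).trans ?_
    rw [mul_pow _ (Q ω)]
    gcongr
  have hQi := hQ2.integrable_sq
  have hEi := hE2.integrable_sq
  calc Var[Z; P] ≤ P[Z ^ 2] := variance_le_expectation_sq hZ2.aestronglyMeasurable
    _ ≤ ∫ ω, 3 * (n : ℝ)⁻¹ * ((n : ℝ)⁻¹ ^ 2 * Q ω ^ 2 + C ^ 2 + E ω ^ 2) ∂P :=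
        integral_mono (f := fun ω => Z ω ^ 2) hZ2.integrable_sq
          ((((hQi.const_mul _).add (integrable_const _)).add hEi).const_mul _) hsq
    _ = 3 * (n : ℝ)⁻¹ * ((n : ℝ)⁻¹ ^ 2 * (∫ ω, Q ω ^ 2 ∂P) + C ^ 2 + ∫ ω, E ω ^ 2 ∂P) := by
        rw [integral_const_mul, integral_add (by fun_prop) (by fun_prop),
          integral_add (by fun_prop) (by fun_prop), integral_const_mul]
        simp
    _ ≤ 3 * (n : ℝ)⁻¹ * ((n : ℝ)⁻¹ ^ 2 * ((4 * C) ^ 2 * n ^ 2) + C ^ 2 + n * ∫ x, e x ^ 2 ∂μ) := by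
        rw [hEn]; gcongr
    _ = 51 * C ^ 2 * (n : ℝ)⁻¹ + 3 * ∫ x, e x ^ 2 ∂μ := by
        generalize ∫ x, e x ^ 2 ∂μ = I
        field_simp
        ring

end Projection

/-! ### Standardization under vanishing `L²` errors -/

section Standardization

variable {Ω : Type*} [MeasurableSpace Ω] {P : Measure Ω} [IsProbabilityMeasure P]

lemma sq_covariance_le {X Y : Ω → ℝ} (hX : MemLp X 2 P) (hY : MemLp Y 2 P) :
    cov[X, Y; P] ^ 2 ≤ Var[X; P] * Var[Y; P] := by
  have h : ∀ t : ℝ, 0 ≤ Var[Y; P] * (t * t) + 2 * cov[X, Y; P] * t + Var[X; P] := fun t => by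
    have h1 := variance_fun_add hX (hY.const_mul t)
    rw [variance_const_mul, covariance_const_mul_right] at h1
    have h2 := variance_nonneg (fun ω => X ω + t * Y ω) P
    rw [h1] at h2
    linarith
  -- the quadratic `t ↦ Var(X + tY)` is nonnegative
  have := discrim_le_zero h
  rw [discrim] at this
  linarith

lemma tendsto_variance_of_tendsto_variance_sub {V L : ℕ → Ω → ℝ} (hV : ∀ n, MemLp (V n) 2 P)
    (hL : ∀ n, MemLp (L n) 2 P) {v : ℝ} (hLv : Tendsto (fun n => Var[L n; P]) atTop (𝓝 v))
    (hVL : Tendsto (fun n => Var[fun ω => V n ω - L n ω; P]) atTop (𝓝 0)) :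
    Tendsto (fun n => Var[V n; P]) atTop (𝓝 v) := by
  have hD : ∀ n, MemLp (fun ω => V n ω - L n ω) 2 P := fun n => (hV n).sub (hL n)
  have hcov : Tendsto (fun n => cov[L n, fun ω => V n ω - L n ω; P]) atTop (𝓝 0) := by
    have h1 : Tendsto (fun n => √(Var[L n; P] * Var[fun ω => V n ω - L n ω; P])) atTop (𝓝 0) := by
      have := (hLv.mul hVL).sqrt
      simpa using this
    refine squeeze_zero_norm (fun n => ?_) h1
    exact Real.abs_le_sqrt (sq_covariance_le (hL n) (hD n))
  have h := (hLv.add (hcov.const_mul 2)).add hVL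
  simp only [mul_zero, add_zero] at h
  refine h.congr fun n => ?_
  rw [← variance_fun_add (hL n) (hD n)]
  simp

/-- If `V n` differs in `L²` from a centered sequence of asymptotic variance one by a sequence whose
variance vanishes, then the standardization of `V n` has the same limit in law. -/
lemma tendstoInDistribution_standardize {Ω' : Type*} [MeasurableSpace Ω'] {P' : Measure Ω'}
    [IsProbabilityMeasure P'] {Z : Ω' → ℝ} {V L : ℕ → Ω → ℝ} (hV : ∀ n, MemLp (V n) 2 P)
    (hL : ∀ n, MemLp (L n) 2 P) (hLZ : TendstoInDistribution L atTop Z (fun _ => P) P')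
    (hL0 : ∀ n, P[L n] = 0) (hL1 : Tendsto (fun n => Var[L n; P]) atTop (𝓝 1))
    (hVL : Tendsto (fun n => Var[fun ω => V n ω - L n ω; P]) atTop (𝓝 0)) :
    TendstoInDistribution (fun n ω => (V n ω - P[V n]) / √(Var[V n; P])) atTop Z
      (fun _ => P) P' := by
  have hD : ∀ n, MemLp (fun ω => V n ω - L n ω) 2 P := fun n => (hV n).sub (hL n)
  have hmean : ∀ n, P[fun ω => V n ω - L n ω] = P[V n] := fun n => by
    rw [integral_sub ((hV n).integrable one_le_two) ((hL n).integrable one_le_two), hL0, sub_zero]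
  have hcentered : TendstoInDistribution (fun n ω => V n ω - P[V n]) atTop Z (fun _ => P) P' := by
    refine tendstoInDistribution_of_tendstoInMeasure_sub _ Z hLZ ?_
      fun n => (hV n).aemeasurable.sub_const _
    rw [tendstoInMeasure_iff_norm]
    intro ε hε
    have hbound : Tendsto (fun n => ENNReal.ofReal (Var[fun ω => V n ω - L n ω; P] / ε ^ 2)) atTop
        (𝓝 0) := by
      have := ENNReal.tendsto_ofReal (hVL.div_const (ε ^ 2))
      simpa using this
    refine tendsto_of_tendsto_of_tendsto_of_le_of_le tendsto_const_nhds hbound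
      (fun _ => zero_le) fun n => ?_
    refine le_trans (measure_mono fun ω hω => ?_) (meas_ge_le_variance_div_sq (hD n) hε)
    simp only [Set.mem_ofPred_eq, hmean, Pi.sub_apply, Pi.zero_apply, sub_zero,
      Real.norm_eq_abs] at hω ⊢
    convert hω using 2
    ring
  have hs : Tendsto (fun n => (√(Var[V n; P]))⁻¹) atTop (𝓝 1) := by
    have := (tendsto_variance_of_tendsto_variance_sub hV hL hL1 hVL).sqrt.inv₀ (by simp)
    simpa using this
  have := hcentered.continuous_comp_prodMk_of_tendstoInMeasure_const
    (g := fun p : ℝ × ℝ => p.1 * p.2) (by fun_prop) (c := 1)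
    (Y := fun n (_ : Ω) => (√(Var[V n; P]))⁻¹)
    (tendstoInMeasure_of_tendsto_ae (fun n => aestronglyMeasurable_const) (.of_forall fun _ => hs))
    (fun n => aemeasurable_const)
  simpa only [div_eq_mul_inv, mul_one] using this

end Standardization

/-! ### Double sums with a varying kernel -/

section DoubleSum

variable {Ω : Type*} [MeasurableSpace Ω] {P : Measure Ω} [IsProbabilityMeasure P]
  {μ : Measure ℝ} [IsProbabilityMeasure μ] {X : ℕ → Ω → ℝ}

/-- The double sum with kernels `g n → g'` is asymptotically equivalent in `L²` to `n ∑ a(Xᵢ)`, where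
`a(x) = E g'(x, X)` is built from the limit kernel. -/
lemma tendsto_variance_sum_le_pairs_sub (hX : ∀ i, HasLaw (X i) μ P) (hind : iIndepFun X P)
    {g : ℕ → ℝ → ℝ → ℝ} (hg : ∀ n, Measurable (Function.uncurry (g n)))
    (hsymm : ∀ n x y, g n x y = g n y x) {C : ℝ} (hC : ∀ n x y, |g n x y| ≤ C)
    {g' : ℝ → ℝ → ℝ} (hg' : Measurable (Function.uncurry g')) (hC' : ∀ x y, |g' x y| ≤ C)
    (hlim : ∀ x, ∀ᵐ y ∂μ, Tendsto (fun n => g n x y) atTop (𝓝 (g' x y))) :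
    Tendsto (fun n : ℕ => Var[fun ω => (√n)⁻¹ *
      ((∑ j ∈ Finset.range n, ∑ i ∈ Finset.range (j + 1), g n (X i ω) (X j ω)) / n
        - ∑ i ∈ Finset.range n, ∫ y, g' (X i ω) y ∂μ); P]) atTop (𝓝 0) := by
  have hC0 : 0 ≤ C := (abs_nonneg _).trans (hC' 0 0)
  set a : ℕ → ℝ → ℝ := fun n x => ∫ y, g n x y ∂μ
  set a' : ℝ → ℝ := fun x => ∫ y, g' x y ∂μ
  have ha : ∀ n, Measurable (a n) := fun n =>
    ((hg n).stronglyMeasurable.integral_prod_right (ν := μ)).measurable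
  have ha' : Measurable a' := (hg'.stronglyMeasurable.integral_prod_right (ν := μ)).measurable
  have haC : ∀ n x, |a n x| ≤ C := fun n x => by
    have := norm_integral_le_of_norm_le_const (μ := μ) (f := g n x) (C := C) (.of_forall (hC n x))
    simpa using this
  have haC' : ∀ x, |a' x| ≤ C := fun x => by
    have := norm_integral_le_of_norm_le_const (μ := μ) (f := g' x) (C := C) (.of_forall (hC' x))
    simpa using this
  have hmC : ∀ n, |∫ x, a n x ∂μ| ≤ C := fun n => by
    have := norm_integral_le_of_norm_le_const (μ := μ) (f := a n) (C := C) (.of_forall (haC n))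
    simpa using this
  have hmC' : |∫ x, a' x ∂μ| ≤ C := by
    have := norm_integral_le_of_norm_le_const (μ := μ) (f := a') (C := C) (.of_forall haC')
    simpa using this
  have halim : ∀ x, Tendsto (fun n => a n x) atTop (𝓝 (a' x)) := fun x =>
    tendsto_integral_of_dominated_convergence (fun _ => C)
      (fun n => ((hg n).comp measurable_prodMk_left).aestronglyMeasurable) (integrable_const _)
      (fun n => .of_forall (hC n x)) (hlim x)
  have hmlim : Tendsto (fun n => ∫ x, a n x ∂μ) atTop (𝓝 (∫ x, a' x ∂μ)) :=
    tendsto_integral_of_dominated_convergence (fun _ => C)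
      (fun n => (ha n).aestronglyMeasurable) (integrable_const _)
      (fun n => .of_forall (haC n)) (.of_forall halim)
  have hinv : Tendsto (fun n : ℕ => (n : ℝ)⁻¹) atTop (𝓝 0) := tendsto_inv_atTop_nhds_zero_nat
  have hinv1 : ∀ n : ℕ, (n : ℝ)⁻¹ ≤ 1 := fun n => Nat.cast_inv_le_one n
  have herr : Tendsto (fun n : ℕ => ∫ x, ((1 - (n : ℝ)⁻¹) * (a n x - ∫ x, a n x ∂μ)
      - (a' x - ∫ x, a' x ∂μ)) ^ 2 ∂μ) atTop (𝓝 0) := by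
    have h0 : (0 : ℝ) = ∫ _x, (0 : ℝ) ∂μ := by simp
    rw [h0]
    refine tendsto_integral_of_dominated_convergence (fun _ => (4 * C) ^ 2) (fun n => ?_)
      (integrable_const _) (fun n => .of_forall fun x => ?_) (.of_forall fun x => ?_)
    · have := ha n
      exact Measurable.aestronglyMeasurable (by fun_prop)
    · rw [norm_pow]
      gcongr
      have h1 : |a n x - ∫ x, a n x ∂μ| ≤ 2 * C :=
        (abs_sub _ _).trans (by linarith [haC n x, hmC n])
      have h2 : |a' x - ∫ x, a' x ∂μ| ≤ 2 * C :=
        (abs_sub _ _).trans (by linarith [haC' x])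
      have hni : 0 ≤ (n : ℝ)⁻¹ := by positivity
      have h3 : |(1 - (n : ℝ)⁻¹) * (a n x - ∫ x, a n x ∂μ)| ≤ 1 * (2 * C) := by
        rw [abs_mul]
        exact mul_le_mul (abs_le.2 ⟨by linarith [hinv1 n], by linarith⟩) h1 (abs_nonneg _)
          zero_le_one
      exact (abs_sub _ _).trans (by linarith)
    · have := ((((hinv.const_sub 1).mul ((halim x).sub hmlim))).sub
        (tendsto_const_nhds (x := a' x - ∫ x, a' x ∂μ))).pow 2
      simpa using this
  have hbound := (hinv.const_mul (51 * C ^ 2)).add (herr.const_mul 3)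
  simp only [mul_zero, add_zero] at hbound
  refine tendsto_of_tendsto_of_tendsto_of_le_of_le' tendsto_const_nhds hbound
    (.of_forall fun n => variance_nonneg _ _) ?_
  filter_upwards [eventually_ge_atTop 1] with n hn
  exact variance_sum_le_pairs_sub_le hX hind (hg n) (hsymm n) (hC n) ha' haC' hn

/-- **Central limit theorem for double sums with a varying kernel.** If the symmetric, uniformly
bounded kernels `g n` converge to `g'` and `x ↦ E g'(x, X)` has positive variance, then
`∑_{i ≤ j < n} g n (Xᵢ, Xⱼ)` is asymptotically normal. -/
theorem tendstoInDistribution_standardized_sum_le_pairs {Ω' : Type*} [MeasurableSpace Ω']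
    {P' : Measure Ω'} [IsProbabilityMeasure P'] {Z : Ω' → ℝ} (hZ : HasLaw Z (gaussianReal 0 1) P')
    (hX : ∀ i, HasLaw (X i) μ P) (hind : iIndepFun X P)
    {g : ℕ → ℝ → ℝ → ℝ} (hg : ∀ n, Measurable (Function.uncurry (g n)))
    (hsymm : ∀ n x y, g n x y = g n y x) {C : ℝ} (hC : ∀ n x y, |g n x y| ≤ C)
    {g' : ℝ → ℝ → ℝ} (hg' : Measurable (Function.uncurry g')) (hC' : ∀ x y, |g' x y| ≤ C)
    (hlim : ∀ x, ∀ᵐ y ∂μ, Tendsto (fun n => g n x y) atTop (𝓝 (g' x y)))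
    (hvar : 0 < Var[fun x => ∫ y, g' x y ∂μ; μ])
    {W : ℕ → Ω → ℝ} (hW : ∀ n ω, W n ω
      = ∑ j ∈ Finset.range n, ∑ i ∈ Finset.range (j + 1), g n (X i ω) (X j ω)) :
    (∀ n, MemLp (W n) 2 P) ∧ (∀ᶠ n in atTop, 0 < Var[W n; P]) ∧
      TendstoInDistribution (fun n ω => (W n ω - P[W n]) / √(Var[W n; P])) atTop Z
        (fun _ => P) P' := by
  have hm : ∀ i, AEMeasurable (X i) P := fun i => (hX i).aemeasurable
  have hW2 : ∀ n, MemLp (W n) 2 P := fun n => by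
    have : W n = fun ω => ∑ j ∈ Finset.range n, ∑ i ∈ Finset.range (j + 1), g n (X i ω) (X j ω) :=
      funext (hW n)
    rw [this]
    exact memLp_finsetSum _ fun j _ => memLp_finsetSum _ fun i _ =>
      .of_bound ((hg n).comp_aemeasurable ((hm i).prodMk (hm j))).aestronglyMeasurable C
        (.of_forall fun ω => hC n _ _)
  set a : ℝ → ℝ := fun x => ∫ y, g' x y ∂μ
  have ha : Measurable a := (hg'.stronglyMeasurable.integral_prod_right (ν := μ)).measurable
  have haC : ∀ x, |a x| ≤ C := fun x => by
    have := norm_integral_le_of_norm_le_const (μ := μ) (f := g' x) (C := C) (.of_forall (hC' x))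
    simpa using this
  have hai : Integrable a μ := .of_bound ha.aestronglyMeasurable C (.of_forall haC)
  set m := ∫ x, a x ∂μ
  set σ := √(Var[a; μ]) with hσ_def
  have hσ : 0 < σ := Real.sqrt_pos.2 hvar
  set b : ℝ → ℝ := fun x => σ⁻¹ * (a x - m)
  have hb : Measurable b := by fun_prop
  have hbC : ∀ x, |b x| ≤ σ⁻¹ * (C + |m|) := fun x => by
    rw [abs_mul, abs_of_pos (inv_pos.2 hσ)]
    gcongr
    exact (abs_sub _ _).trans (by linarith [haC x])
  have hb0 : ∫ x, b x ∂μ = 0 := by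
    simp only [b]
    rw [integral_const_mul, integral_sub hai (integrable_const _)]
    simp [m]
  have hb1 : ∫ x, b x ^ 2 ∂μ = 1 := by
    simp only [b, mul_pow]
    rw [integral_const_mul, ← variance_eq_integral ha.aemeasurable, inv_pow, hσ_def,
      Real.sq_sqrt hvar.le, inv_mul_cancel₀ hvar.ne']
  have hbm : ∀ i, AEMeasurable (fun ω => b (X i ω)) P := fun i => hb.comp_aemeasurable (hm i)
  have hbX0 : ∀ i, ∫ ω, b (X i ω) ∂P = 0 := fun i =>
    ((hX i).integral_comp hb.aestronglyMeasurable).trans hb0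
  have hb2 : ∀ i, MemLp (fun ω => b (X i ω)) 2 P := fun i =>
    .of_bound (hbm i).aestronglyMeasurable _ (.of_forall fun ω => hbC _)
  set L : ℕ → Ω → ℝ := fun n ω => (√n)⁻¹ * ∑ i ∈ Finset.range n, b (X i ω)
  have hLZ : TendstoInDistribution L atTop Z (fun _ => P) P' := by
    refine tendstoInDistribution_inv_sqrt_mul_sum (X := fun i ω => b (X i ω)) hZ (hbX0 0) ?_
      (hind.comp (fun _ => b) fun _ => hb) fun i => ?_
    · exact ((hX 0).integral_comp (f := fun x => b x ^ 2) (by fun_prop)).trans hb1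
    · have : IdentDistrib (X i) (X 0) P P := ⟨hm i, hm 0, by rw [(hX i).map_eq, (hX 0).map_eq]⟩
      exact this.comp hb
  have hL2 : ∀ n, MemLp (L n) 2 P := fun n => (memLp_finsetSum _ fun i _ => hb2 i).const_mul _
  have hL0 : ∀ n, P[L n] = 0 := fun n => by
    simp only [L]
    rw [integral_const_mul, integral_finsetSum _ fun i _ => (hb2 i).integrable one_le_two]
    simp [hbX0]
  have hL1 : Tendsto (fun n => Var[L n; P]) atTop (𝓝 1) := by
    refine tendsto_const_nhds.congr' ?_
    filter_upwards [eventually_ge_atTop 1] with n hn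
    have hn0 : (0 : ℝ) < n := by exact_mod_cast hn
    rw [variance_of_integral_eq_zero (hL2 n).aemeasurable (hL0 n)]
    simp only [L, mul_pow]
    rw [integral_const_mul, integral_sq_sum_of_centered hX hind hb hbC hb0, hb1, inv_pow,
      Real.sq_sqrt hn0.le, mul_one, inv_mul_cancel₀ hn0.ne']
  set r : ℕ → ℝ := fun n => σ⁻¹ * ((√n)⁻¹ / n)
  have hr : ∀ n, 1 ≤ n → 0 < r n := fun n hn => by
    have hn0 : (0 : ℝ) < n := by exact_mod_cast hn
    simp only [r]
    positivity
  set V : ℕ → Ω → ℝ := fun n ω => r n * W n ω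
  have hV2 : ∀ n, MemLp (V n) 2 P := fun n => (hW2 n).const_mul _
  have hVL : Tendsto (fun n => Var[fun ω => V n ω - L n ω; P]) atTop (𝓝 0) := by
    have h := (tendsto_variance_sum_le_pairs_sub hX hind hg hsymm hC hg' hC' hlim).const_mul
      (σ⁻¹ ^ 2)
    rw [mul_zero] at h
    refine h.congr fun n => ?_
    rw [← variance_const_mul, ← variance_add_const (c := σ⁻¹ * (√n)⁻¹ * (n * m))]
    · congr 1
      funext ω
      simp only [V, L, r, b, ← Finset.mul_sum, Finset.sum_sub_distrib, hW]
      simp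
      ring
    · refine AEMeasurable.aestronglyMeasurable ?_
      have h1 : AEMeasurable (W n) P := (hW2 n).aemeasurable
      simp only [← hW]
      have h2 : ∀ i, AEMeasurable (fun ω => a (X i ω)) P := fun i => ha.comp_aemeasurable (hm i)
      exact (((h1.div_const _).sub
        (Finset.aemeasurable_fun_sum _ fun i _ => h2 i)).const_mul _).const_mul _
  have hvarV : ∀ n, Var[V n; P] = r n ^ 2 * Var[W n; P] := fun n => variance_const_mul _ _ _
  refine ⟨hW2, ?_, ?_⟩
  · have h1 := tendsto_variance_of_tendsto_variance_sub hV2 hL2 hL1 hVL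
    filter_upwards [h1.eventually (lt_mem_nhds one_pos)] with n hn
    rw [hvarV] at hn
    exact pos_of_mul_pos_right hn (sq_nonneg _)
  · refine (tendstoInDistribution_standardize hV2 hL2 hLZ hL0 hL1 hVL).congr (fun n => ?_)
      (Filter.EventuallyEq.refl _ _)
    refine .of_forall fun ω => ?_
    rcases Nat.eq_zero_or_pos n with rfl | hn
    -- for `n = 0` the scale `r 0` is zero, but `W 0` is an empty sum
    · have h0 : W 0 = fun _ => 0 := funext fun ω => by simp [hW]
      simp [V, h0]
    · have hE : P[V n] = r n * P[W n] := integral_const_mul _ _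
      have hrn := hr n hn
      simp only [hE, hvarV]
      rw [Real.sqrt_mul (sq_nonneg _), Real.sqrt_sq hrn.le, ← mul_sub, mul_div_mul_left _ _ hrn.ne']

end DoubleSum

/-! ### The integrated kernel -/

section IntegratedKernel

variable {k : ℝ → ℝ}

lemma abs_primitiveFromBot_le (hk : Integrable k) (x : ℝ) :
    |primitiveFromBot k x| ≤ ∫ u, |k u| :=
  (abs_integral_le_integral_abs).trans
    (setIntegral_le_integral hk.abs (.of_forall fun _ => abs_nonneg _))

lemma continuous_primitiveFromBot (hk : Integrable k) : Continuous (primitiveFromBot k) := by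
  have h : primitiveFromBot k = fun x => primitiveFromBot k 0 + ∫ u in (0 : ℝ)..x, k u := by
    funext x
    rw [← intervalIntegral.integral_Iic_sub_Iic hk.integrableOn hk.integrableOn]
    simp [primitiveFromBot]
  rw [h]
  exact continuous_const.add (intervalIntegral.continuous_primitive
    (fun _ _ => hk.intervalIntegrable) 0)

lemma tendsto_primitiveFromBot_atTop (hk : Integrable k) :
    Tendsto (primitiveFromBot k) atTop (𝓝 (∫ u, k u)) :=
  (aecover_Iic tendsto_id).integral_tendsto_of_countably_generated hk

lemma tendsto_primitiveFromBot_atBot :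
    Tendsto (primitiveFromBot k) atBot (𝓝 0) :=
  tendsto_integral_Iic_zero tendsto_id

/-- The smoothed indicator `1 - K(-s / (2h))` converges to the indicator of `s > 0` as `h ↓ 0`,
except at the jump `s = 0`. -/
lemma tendsto_one_sub_primitiveFromBot (hk : Integrable k) (hk_one : ∫ u, k u = 1) {h : ℕ → ℝ}
    (hpos : ∀ᶠ n in atTop, 0 < h n) (hlim : Tendsto h atTop (𝓝 0)) {s : ℝ} (hs : s ≠ 0) :
    Tendsto (fun n => 1 - primitiveFromBot k (-(s / (2 * h n)))) atTop
      (𝓝 (if 0 < s then 1 else 0)) := by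
  have h2 : Tendsto (fun n => 2 * h n) atTop (𝓝[>] 0) := by
    refine tendsto_nhdsWithin_iff.2 ⟨by simpa using hlim.const_mul 2, ?_⟩
    filter_upwards [hpos] with n hn
    simpa using hn
  have hinv : Tendsto (fun n => (2 * h n)⁻¹) atTop atTop := h2.inv_tendsto_nhdsGT_zero
  rcases hs.lt_or_gt with hs | hs
  · have h3 : Tendsto (fun n => -(s / (2 * h n))) atTop atTop := by
      simpa [div_eq_mul_inv] using hinv.const_mul_atTop (neg_pos.2 hs)
    simpa [hs.not_gt, hk_one] using ((tendsto_primitiveFromBot_atTop hk).comp h3).const_sub 1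
  · have h3 : Tendsto (fun n => -(s / (2 * h n))) atTop atBot :=
      tendsto_neg_atTop_atBot.comp (by simpa only [div_eq_mul_inv] using hinv.const_mul_atTop hs)
    simpa [hs] using (tendsto_primitiveFromBot_atBot.comp h3).const_sub 1

end IntegratedKernel

/-! ### Positivity of the limiting variance -/

section Nondegeneracy

/-- A constant value of `x ↦ μ(-x, ∞)` must be `μ(0, ∞)`, so that `(0, -y]` and `(-x, 0]` are null
for almost all `y < 0 < x`. Since one of `x ≤ -y` and `-x < y` holds, almost no pair
satisfies `y < 0 < x`. -/
lemma not_ae_eq_const_measureReal_Ioi_neg {μ : Measure ℝ} [IsProbabilityMeasure μ]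
    (hneg : μ (Set.Iio 0) ≠ 0) (hpos : μ (Set.Ioi 0) ≠ 0) (c : ℝ) :
    ¬ ∀ᵐ x ∂μ, μ.real (Set.Ioi (-x)) = c := by
  intro hc
  obtain ⟨y₀, hy₀, hy₀c⟩ : ∃ y ∈ Set.Iio (0 : ℝ), μ.real (Set.Ioi (-y)) = c :=
    ((frequently_ae_mem_iff.2 hneg).and_eventually hc).exists
  obtain ⟨x₀, hx₀, hx₀c⟩ : ∃ x ∈ Set.Ioi (0 : ℝ), μ.real (Set.Ioi (-x)) = c :=
    ((frequently_ae_mem_iff.2 hpos).and_eventually hc).exists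
  have hp : μ.real (Set.Ioi 0) = c := by
    refine le_antisymm ?_ ?_
    · rw [← hx₀c]
      exact measureReal_mono (Set.Ioi_subset_Ioi (by simpa using (Set.mem_Ioi.1 hx₀).le))
    · rw [← hy₀c]
      exact measureReal_mono (Set.Ioi_subset_Ioi (by simpa using (Set.mem_Iio.1 hy₀).le))
  have hIoc : ∀ s t : ℝ, s ≤ t → μ.real (Set.Ioi s) = μ.real (Set.Ioi t) →
      μ (Set.Ioc s t) = 0 := fun s t hst h => by
    have h1 : Set.Ioc s t = Set.Ioi s \ Set.Ioi t := by
      ext u; simp [and_comm]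
    have h2 := measureReal_sdiff (μ := μ) (Set.Ioi_subset_Ioi hst) measurableSet_Ioi
    rw [← h1, h, sub_self] at h2
    exact (measureReal_eq_zero_iff).1 h2
  set A : Set (ℝ × ℝ) := {p | p.1 < 0 ∧ 0 < p.2 ∧ p.2 ≤ -p.1}
  set B : Set (ℝ × ℝ) := {p | 0 < p.1 ∧ -p.1 < p.2 ∧ p.2 ≤ 0}
  have hAm : MeasurableSet A := by
    refine (measurableSet_lt measurable_fst measurable_const).inter
      ((measurableSet_lt measurable_const measurable_snd).inter
        (measurableSet_le measurable_snd measurable_fst.neg))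
  have hBm : MeasurableSet B := by
    refine (measurableSet_lt measurable_const measurable_fst).inter
      ((measurableSet_lt measurable_fst.neg measurable_snd).inter
        (measurableSet_le measurable_snd measurable_const))
  have hA : (μ.prod μ) A = 0 := by
    rw [Measure.measure_prod_null hAm]
    filter_upwards [hc] with y hy
    by_cases h0 : y < 0
    · exact measure_mono_null (t := Set.Ioc 0 (-y)) (fun x hx => ⟨hx.2.1, hx.2.2⟩)
        (hIoc 0 (-y) (by linarith) (hp.trans hy.symm))
    · have : Prod.mk y ⁻¹' A = ∅ := by
        ext x; simp [A, h0]
      simp [this]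
  have hB : (μ.prod μ) B = 0 := by
    rw [Measure.measure_prod_null hBm]
    filter_upwards [hc] with x hx
    by_cases h0 : 0 < x
    · exact measure_mono_null (t := Set.Ioc (-x) 0) (fun y hy => ⟨hy.2.1, hy.2.2⟩)
        (hIoc (-x) 0 (by linarith) (hx.trans hp.symm))
    · have : Prod.mk x ⁻¹' B = ∅ := by
        ext y; simp [B, h0]
      simp [this]
  have hB' : (μ.prod μ) (Prod.swap ⁻¹' B) = 0 := by
    rw [← Measure.map_apply measurable_swap hBm, Measure.prod_swap, hB]
  have hsub : Set.Iio (0 : ℝ) ×ˢ Set.Ioi (0 : ℝ) ⊆ A ∪ Prod.swap ⁻¹' B := by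
    rintro ⟨y, x⟩ ⟨hy, hx⟩
    simp only [Set.mem_Iio, Set.mem_Ioi] at hy hx
    rcases le_or_gt x (-y) with h | h
    · exact Or.inl ⟨hy, hx, h⟩
    · exact Or.inr ⟨hx, by simp only [Prod.swap]; linarith, hy.le⟩
  have h0 := measure_mono_null hsub (measure_union_null hA hB')
  rw [Measure.prod_prod, mul_eq_zero] at h0
  exact h0.elim hneg hpos

/-- For the density `f (x - θ)` with `f` even, `P(X > 0) = F(θ)`. -/
lemma withDensity_location_Ioi_zero {f : ℝ → ℝ} (hf_nonneg : ∀ x, 0 ≤ f x) (hf_int : Integrable f)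
    (hf_symm : ∀ x, f (-x) = f x) (θ : ℝ) :
    (volume.withDensity fun x => ENNReal.ofReal (f (x - θ))) (Set.Ioi 0)
      = ENNReal.ofReal (primitiveFromBot f θ) := by
  have h1 : primitiveFromBot f θ = ∫ x in Set.Ioi 0, f (x - θ) := by
    have h2 := integral_comp_neg_Iic θ f
    simp only [hf_symm] at h2
    have h3 := (measurePreserving_sub_right volume θ).setIntegral_preimage_emb
      (MeasurableEquiv.subRight θ).measurableEmbedding f (Set.Ioi (-θ))
    rw [primitiveFromBot, h2, ← h3]
    congr 2
    ext x; simp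
  rw [withDensity_apply _ measurableSet_Ioi, h1, ofReal_integral_eq_lintegral_ofReal
    (hf_int.comp_sub_right θ).integrableOn (.of_forall fun x => hf_nonneg _)]

end Nondegeneracy

/-! ### The smoothed Wilcoxon statistic -/

section SmoothedWilcoxon

variable {Ω : Type*} [MeasurableSpace Ω] {P : Measure Ω} [IsProbabilityMeasure P]

/-- Asymptotic normality of the smoothed Wilcoxon statistic for an atomless law charging both open
half-lines; the bandwidths need only be eventually positive and tend to zero. -/
theorem tendstoInDistribution_standardized_smoothedWilcoxon {μ : Measure ℝ}
    [IsProbabilityMeasure μ] (hμ0 : ∀ x, μ {x} = 0) (hneg : μ (Set.Iio 0) ≠ 0)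
    (hpos : μ (Set.Ioi 0) ≠ 0) {X : ℕ → Ω → ℝ} (hX : ∀ i, HasLaw (X i) μ P) (hind : iIndepFun X P)
    {k : ℝ → ℝ} (hk : Integrable k) (hk_one : ∫ u, k u = 1) {h : ℕ → ℝ}
    (hh_pos : ∀ᶠ n in atTop, 0 < h n) (hh_lim : Tendsto h atTop (𝓝 0)) {W : ℕ → Ω → ℝ}
    (hW : ∀ n ω, W n ω = smoothedWilcoxon k (h n) n (fun i => X i ω)) :
    (∀ n, MemLp (W n) 2 P) ∧ (∀ᶠ n in atTop, 0 < Var[W n; P]) ∧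
      TendstoInDistribution (fun n ω => (W n ω - P[W n]) / √(Var[W n; P])) atTop
        (id : ℝ → ℝ) (fun _ => P) (gaussianReal 0 1) := by
  set g' : ℝ → ℝ → ℝ := fun x y => if 0 < x + y then 1 else 0
  have ha : (fun x => ∫ y, g' x y ∂μ) = fun x => μ.real (Set.Ioi (-x)) := by
    funext x
    rw [← integral_indicator_one measurableSet_Ioi]
    refine integral_congr_ae (.of_forall fun y => ?_)
    simp only [g', Set.indicator_apply, Set.mem_Ioi, Pi.one_apply, neg_lt_iff_pos_add']
  have hg' : Measurable (Function.uncurry g') :=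
    Measurable.ite (measurableSet_lt measurable_const (measurable_fst.add measurable_snd))
      measurable_const measurable_const
  have hg'1 : ∀ x y, |g' x y| ≤ 1 := fun x y => by
    simp only [g']
    split_ifs <;> simp
  have ha2 : MemLp (fun x => ∫ y, g' x y ∂μ) 2 μ :=
    .of_bound (hg'.stronglyMeasurable.integral_prod_right (ν := μ)).aestronglyMeasurable 1
      (.of_forall fun x => by
        have := norm_integral_le_of_norm_le_const (μ := μ) (f := g' x) (C := 1)
          (.of_forall (hg'1 x))
        simpa using this)
  have hvar : 0 < Var[fun x => ∫ y, g' x y ∂μ; μ] := by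
    refine (variance_nonneg _ _).lt_of_ne' fun h0 => ?_
    have h1 := ae_eq_integral_of_variance_eq_zero ha2 h0
    exact not_ae_eq_const_measureReal_Ioi_neg hneg hpos _
      (h1.mono fun x hx => (congrFun ha x).symm.trans hx)
  have hI : 0 ≤ ∫ u, |k u| := integral_nonneg fun _ => abs_nonneg _
  refine tendstoInDistribution_standardized_sum_le_pairs (μ := μ) (C := 1 + ∫ u, |k u|)
    (g := fun n x y => 1 - primitiveFromBot k (-((x + y) / (2 * h n)))) (HasLaw.id (μ := gaussianReal 0 1))
    hX hind
    (fun n => ?_) (fun n x y => by rw [add_comm]) (fun n x y => ?_) hg'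
    (fun x y => (hg'1 x y).trans (by linarith)) (fun x => ?_) hvar fun n ω => ?_
  · have := (continuous_primitiveFromBot hk).measurable
    exact (this.comp (f := fun p : ℝ × ℝ => -((p.1 + p.2) / (2 * h n)))
      (by fun_prop)).const_sub 1
  · refine (abs_sub _ _).trans ?_
    rw [abs_one]
    gcongr
    exact abs_primitiveFromBot_le hk _
  · have hne : ∀ᵐ y ∂μ, y ≠ -x := by
      rw [ae_iff]
      simpa using hμ0 (-x)
    filter_upwards [hne] with y hy
    exact tendsto_one_sub_primitiveFromBot hk hk_one hh_pos hh_lim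
      fun h0 => hy (by linarith)
  · simp only [hW, smoothedWilcoxon, Finset.sum_sub_distrib]
    rw [sum_le_pairs_const, mul_one]

end SmoothedWilcoxon

theorem theorem5
    {Ω : Type*} [MeasurableSpace Ω] (P : Measure Ω) [IsProbabilityMeasure P]
    -- the symmetric density `f` and the location parameter `θ`
    (f : ℝ → ℝ) (θ : ℝ)
    (hf_nonneg : ∀ x, 0 ≤ f x) (hf_int : Integrable f) (hf_one : ∫ x, f x = 1)
    (hf_symm : ∀ x, f (-x) = f x)
    -- `f'` exists and is continuous in a neighbourhood of `-θ`
    (hf_deriv : ∃ U ∈ 𝓝 (-θ), (∀ x ∈ U, DifferentiableAt ℝ f x) ∧ ContinuousOn (deriv f) U)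
    -- non-degeneracy: `0 < F(θ) < 1`
    (hF_pos : 0 < primitiveFromBot f θ) (hF_lt : primitiveFromBot f θ < 1)
    -- the i.i.d. observations, with density `f (x - θ)`
    (X : ℕ → Ω → ℝ)
    (hX_law : ∀ i, HasLaw (X i) (volume.withDensity fun x => ENNReal.ofReal (f (x - θ))) P)
    (hX_indep : iIndepFun X P)
    -- the symmetric kernel, which may take negative values
    (k : ℝ → ℝ) (hk_int : Integrable k) (hk_one : ∫ u, k u = 1) (hk_symm : ∀ u, k (-u) = k u)
    -- the bandwidths
    (c d : ℝ) (hc : 0 < c) (hd_lower : 1 / 4 < d) (hd_upper : d < 1 / 2)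
    (h : ℕ → ℝ) (hh : ∀ n : ℕ, 1 ≤ n → h n = c * (n : ℝ) ^ (-d)) :
    let W : ℕ → Ω → ℝ := fun n ω => smoothedWilcoxon k (h n) n (fun i => X i ω)
    -- expectation and variance are finite, and the variance is eventually positive
    (∀ n, MemLp (W n) 2 P) ∧ (∀ᶠ n in atTop, 0 < Var[W n; P]) ∧
      -- the standardized statistic converges in law to `N(0, 1)`
      TendstoInDistribution (fun n ω => (W n ω - P[W n]) / √(Var[W n; P])) atTop
        (id : ℝ → ℝ) (fun _ => P) (gaussianReal 0 1) := by
  intro W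
  set μ : Measure ℝ := volume.withDensity fun x => ENNReal.ofReal (f (x - θ))
  have : IsProbabilityMeasure μ := (hX_law 0).isProbabilityMeasure_iff.1 inferInstance
  have hμ0 : ∀ x, μ {x} = 0 := fun x => withDensity_absolutelyContinuous _ _ (by simp)
  have hIoi : μ (Set.Ioi 0) = ENNReal.ofReal (primitiveFromBot f θ) :=
    withDensity_location_Ioi_zero hf_nonneg hf_int hf_symm θ
  have hpos : μ (Set.Ioi 0) ≠ 0 := by
    rw [hIoi]
    simpa using hF_pos
  have hneg : μ (Set.Iio 0) ≠ 0 := by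
    intro h0
    have h1 : μ (Set.Iic 0) = 0 := by
      rw [← Set.Iio_union_right]
      exact measure_union_null h0 (hμ0 0)
    have h2 : μ (Set.Ioi 0) = 1 := by
      rw [← Set.compl_Iic]
      exact (prob_compl_eq_one_iff measurableSet_Iic).2 h1
    rw [hIoi, ENNReal.ofReal_eq_one] at h2
    exact hF_lt.ne h2
  have hh_pos : ∀ᶠ n in atTop, 0 < h n := by
    filter_upwards [eventually_ge_atTop 1] with n hn
    have hn0 : (0 : ℝ) < n := by exact_mod_cast hn
    rw [hh n hn]
    positivity
  have hh_lim : Tendsto h atTop (𝓝 0) := by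
    have h1 : Tendsto (fun n : ℕ => c * (n : ℝ) ^ (-d)) atTop (𝓝 (c * 0)) :=
      ((tendsto_rpow_neg_atTop (by linarith : 0 < d)).comp tendsto_natCast_atTop_atTop).const_mul c
    rw [mul_zero] at h1
    refine h1.congr' ?_
    filter_upwards [eventually_ge_atTop 1] with n hn
    exact (hh n hn).symm
  exact tendstoInDistribution_standardized_smoothedWilcoxon hμ0 hneg hpos hX_law hX_indep hk_int
    hk_one hh_pos hh_lim fun _ _ => rfl
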